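/- Let $N\ge 1$, $\eta>0$, $L>0$, $T\in\mathbb N$. Let $F$ be a probability law on $\mathbb R^N$ that has mean zero (in particular its coordinates are integrable), is absolutely continuous with respect to Lebesgue measure and has full support $\mathbb R^N$. For $s>0$ let $$\varphi_s(\theta)=\mathbb E_{\varepsilon\sim F}\Big[\max_{1\le i\le N}(\theta_i+s\,\varepsilon_i)\Big],\qquad \theta\in\mathbb R^N ,$$ and let $\varphi=\varphi_\eta$ be the social surplus function. Let $\mathcal R(x)=\sup_{\theta\in\mathbb R^N}\{\langle\theta,x\rangle-\varphi(\theta)\}$ be its convex conjugate and $\Delta_N$ the probability simplex in $\mathbb R^N$. Let $u_1,\dots,u_T\in\mathbb R^N$ be payoff vectors and $\theta_t=u_1+\dots+u_t$, $\theta_0=0$. Assume that for $1\le t\le T$ the Hessian of $\varphi$ at $\theta_t$ exists and $2\,\mathrm{Tr}\,\nabla^2\varphi(\theta_t)\le L/\eta$. For $s>0$ define $H=H^{(s)}$ on $\mathbb R^N_{++}=(0,\infty)^N$ as the gradient of the exponentiated surplus, $H(e^{\theta/s})=\nabla\big(e^{\varphi_s}\big)(\theta)$, with exponentials and logarithms of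 vectors taken coordinatewise. Then for every $\theta\in\mathbb R^N$ the problem $\max_{x\in\Delta_N}\{\langle\theta,x\rangle-\mathcal R(x)\}$ has exactly one solution, so that the FTRL choices $$x_{t+1}=\arg\max_{x\in\Delta_N}\{\langle\theta_t,x\rangle-\mathcal R(x)\},\qquad t=0,1,\dots,T,$$ are well defined. Moreover, both for $s=\eta$ (the surplus $\varphi$ itself) and for $s=1$ (the normalization in which $H$ is homogeneous of degree one), $H=H^{(s)}$ is a bijection of $\mathbb R^N_{++}$ onto itself; with $\Phi=H^{-1}$ and $\alpha(x)=\log\Phi(x)$, all coordinates of $x_1,\dots,x_{T+1}$ are positive, and $$x_{t+1,i}=\frac{H_i\big(e^{u_t/\eta+\alpha(x_t)}\big)}{\sum_{j=1}^N H_j\big(e^{u_t/\eta+\alpha(x_t)}\big)}\qquad\text{for all } i=1,\dots,N,\ 1\le t\le T .$$ -/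

import Mathlib

noncomputable section

namespace RumOdp

open MeasureTheory Set

/-- `ℝ^N`, with coordinates indexed by the alternatives. -/
abbrev Vec (N : ℕ) := EuclideanSpace ℝ (Fin N)

/-- The probability simplex `Δ_N`. -/
def simplex (N : ℕ) : Set (Vec N) := {x | (∀ i, 0 ≤ x i) ∧ ∑ i, x i = 1}

/-- The set of vectors all of whose coordinates are positive. -/
def posOrthant (N : ℕ) : Set (Vec N) := {y | ∀ i, 0 < y i}

/-- Coordinatewise exponential. -/
def vexp {N : ℕ} (v : Vec N) : Vec N := WithLp.toLp 2 fun i => Real.exp (v i)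

/-- Coordinatewise logarithm. -/
def vlog {N : ℕ} (y : Vec N) : Vec N := WithLp.toLp 2 fun i => Real.log (y i)

/-- The assumption on the law `F` of the preference shocks: a probability law on `ℝ^N` with mean
zero, absolutely continuous with respect to Lebesgue measure, and with full support. -/
structure ShockAssumption {N : ℕ} (F : Measure (Vec N)) : Prop where
  isProbability : IsProbabilityMeasure F
  integrable : ∀ i, Integrable (fun e : Vec N => e i) F
  mean_zero : ∀ i, ∫ e : Vec N, e i ∂F = 0
  absolutelyContinuous : F ≪ volume
  full_support : ∀ U : Set (Vec N), IsOpen U → U.Nonempty → F U ≠ 0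

/-- The social surplus function `φ(θ) = 𝔼 max_i (θ_i + η ε_i)`, where `ε ∼ F`. -/
def socialSurplus {N : ℕ} (F : Measure (Vec N)) (η : ℝ) (θ : Vec N) : ℝ :=
  ∫ e : Vec N, (⨆ i, (θ i + η * e i)) ∂F

/-- The Hessian matrix at `θ`: the Jacobian matrix of the gradient map. -/
def hessian {N : ℕ} (f : Vec N → ℝ) (θ : Vec N) : Matrix (Fin N) (Fin N) ℝ :=
  Matrix.of fun i j => (fderiv ℝ (gradient f) θ (EuclideanSpace.single j 1)) i

/-- The Hessian of the social surplus function exists at `θ` and `2 Tr ∇²φ(θ) ≤ L / η`. -/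
def HessianTraceBound {N : ℕ} (F : Measure (Vec N)) (η L : ℝ) (θ : Vec N) : Prop :=
  DifferentiableAt ℝ (gradient (socialSurplus F η)) θ ∧
    2 * (hessian (socialSurplus F η) θ).trace ≤ L / η

/-- The regularizer `R`: the convex conjugate of the social surplus function. -/
def regularizer {N : ℕ} (F : Measure (Vec N)) (η : ℝ) (x : Vec N) : EReal :=
  ⨆ θ : Vec N, ((inner ℝ θ x - socialSurplus F η θ : ℝ) : EReal)

/-- `x` belongs to `argmax_{z ∈ Δ_N} {⟨θ, z⟩ - R(z)}`. -/
def IsRegularizedLeader {N : ℕ} (F : Measure (Vec N)) (η : ℝ) (θ x : Vec N) : Prop :=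
  x ∈ simplex N ∧
    IsMaxOn (fun z : Vec N => ((inner ℝ θ z : ℝ) : EReal) - regularizer F η z) (simplex N) x

/-- Cumulative payoff `θ_t = u_1 + ⋯ + u_t`; in particular `θ_0 = 0`. -/
def cumulativePayoff {N : ℕ} (u : ℕ → Vec N) (t : ℕ) : Vec N := ∑ r ∈ Finset.Icc 1 t, u r

/-- `x_1, …, x_{T+1}` are the choices of the FTRL algorithm facing the payoffs `u_1, …, u_T`
(the values of `x` and `u` at other times are irrelevant). The case `t = 0` is the initial choice
`x_1 ∈ argmax (-R)`. -/
def IsFTRL {N : ℕ} (F : Measure (Vec N)) (η : ℝ) (T : ℕ) (u x : ℕ → Vec N) : Prop :=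
  ∀ t ≤ T, IsRegularizedLeader F η (cumulativePayoff u t) (x (t + 1))

/-- The map `H` at scale `s`, on vectors with positive coordinates: the gradient of the
exponentiated surplus, `H (e^{θ/s}) = ∇ (e^{φ_s}) (θ)`, where `φ_s` is the social surplus function
with parameter `s`. -/
def expSurplusGrad {N : ℕ} (F : Measure (Vec N)) (s : ℝ) (y : Vec N) : Vec N :=
  gradient (fun θ : Vec N => Real.exp (socialSurplus F s θ)) (s • vlog y)

theorem expSurplusGrad_vexp {N : ℕ} (F : Measure (Vec N)) {s : ℝ} (hs : 0 < s) (θ : Vec N) :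
    expSurplusGrad F s (vexp (s⁻¹ • θ)) =
      gradient (fun v : Vec N => Real.exp (socialSurplus F s v)) θ := by
  have h : s • vlog (vexp (s⁻¹ • θ)) = θ := by
    ext i
    simp [vlog, vexp, hs.ne']
  rw [expSurplusGrad, h]

/-- `Φ = H⁻¹`, the inverse of `H` on the vectors with positive coordinates. -/
def invExpSurplusGrad {N : ℕ} (F : Measure (Vec N)) (s : ℝ) : Vec N → Vec N :=
  Function.invFunOn (expSurplusGrad F s) (posOrthant N)

/-- `α(x) = log Φ(x)`. -/
def alpha {N : ℕ} (F : Measure (Vec N)) (s : ℝ) (x : Vec N) : Vec N :=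
  vlog (invExpSurplusGrad F s x)

end RumOdp

end

namespace RumOdp

open MeasureTheory Filter Topology

section VecMax

variable {N : ℕ}

/-- The largest coordinate of a vector. -/
noncomputable def vecMax (v : Vec N) : ℝ := ⨆ i, v i

/-- The vector all of whose coordinates equal one. -/
noncomputable def allOnes (N : ℕ) : Vec N := WithLp.toLp 2 fun _ => 1

@[simp] theorem allOnes_apply (i : Fin N) : allOnes N i = 1 := rfl

theorem inner_eq_sum (x y : Vec N) : inner ℝ x y = ∑ i, x i * y i := by
  simp [PiLp.inner_apply, mul_comm]

theorem inner_allOnes (x : Vec N) : inner ℝ x (allOnes N) = ∑ i, x i := by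
  simp [inner_eq_sum]

theorem le_vecMax (v : Vec N) (i : Fin N) : v i ≤ vecMax v :=
  le_ciSup (f := fun i => v i) (Set.finite_range _).bddAbove i

theorem vecMax_smul {c : ℝ} (hc : 0 ≤ c) (v : Vec N) : vecMax (c • v) = c * vecMax v := by
  simp only [vecMax, PiLp.smul_apply, smul_eq_mul, Real.mul_iSup_of_nonneg hc]

/-- A vector with `max d + max (-d) ≤ 0` is constant. -/
theorem eq_smul_allOnes_of_vecMax_add_vecMax_neg_le {d : Vec N}
    (h : vecMax d + vecMax (-d) ≤ 0) : d = vecMax d • allOnes N := by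
  ext i
  have h1 := le_vecMax d i
  have h2 := le_vecMax (-d) i
  simp at h2 ⊢
  linarith

variable [Nonempty (Fin N)]

theorem vecMax_le {v : Vec N} {a : ℝ} (h : ∀ i, v i ≤ a) : vecMax v ≤ a :=
  ciSup_le h

theorem vecMax_le_add_norm (v w : Vec N) : vecMax v ≤ vecMax w + ‖v - w‖ := by
  refine vecMax_le fun i => ?_
  have h1 := le_vecMax w i
  have h2 := (le_abs_self _).trans (PiLp.norm_apply_le (v - w) i)
  simp only [PiLp.sub_apply] at h2
  linarith

theorem lipschitzWith_vecMax : LipschitzWith 1 (vecMax : Vec N → ℝ) := by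
  refine LipschitzWith.of_le_add fun v w => ?_
  rw [dist_eq_norm]
  exact vecMax_le_add_norm v w

theorem continuous_vecMax : Continuous (vecMax : Vec N → ℝ) :=
  lipschitzWith_vecMax.continuous

theorem vecMax_mono {v w : Vec N} (h : ∀ i, v i ≤ w i) : vecMax v ≤ vecMax w :=
  vecMax_le fun i => (h i).trans (le_vecMax w i)

theorem vecMax_add_smul_allOnes (v : Vec N) (c : ℝ) :
    vecMax (v + c • allOnes N) = vecMax v + c := by
  apply le_antisymm
  · refine vecMax_le fun i => ?_
    simpa using le_vecMax v i
  · rw [← le_sub_iff_add_le]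
    refine vecMax_le fun i => ?_
    have := le_vecMax (v + c • allOnes N) i
    simp at this
    linarith

theorem vecMax_add_le (v w : Vec N) : vecMax (v + w) ≤ vecMax v + vecMax w :=
  vecMax_le fun i => add_le_add (le_vecMax v i) (le_vecMax w i)

theorem vecMax_zero : vecMax (0 : Vec N) = 0 := by
  simp [vecMax]

end VecMax

section Surplus

variable {N : ℕ} {F : Measure (Vec N)} {s : ℝ}

theorem socialSurplus_eq (F : Measure (Vec N)) (s : ℝ) (θ : Vec N) :
    socialSurplus F s θ = ∫ e, vecMax (θ + s • e) ∂F := rfl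

theorem ShockAssumption.isOpenPosMeasure (hF : ShockAssumption F) : F.IsOpenPosMeasure :=
  ⟨hF.full_support⟩

theorem ShockAssumption.integrable_id (hF : ShockAssumption F) :
    Integrable (fun e : Vec N => e) F := by
  have h : (fun e : Vec N => e) = fun e => ∑ i, e i • EuclideanSpace.single i (1 : ℝ) := by
    funext e
    ext j
    simp [Pi.single_apply]
  rw [h]
  exact integrable_finsetSum _ fun i _ => (hF.integrable i).smul_const _

/-- Continuous integrable functions with a pointwise inequality that is strict somewhere have
strictly ordered integrals against a law of full support. -/
theorem ShockAssumption.integral_lt_integral (hF : ShockAssumption F) {f g : Vec N → ℝ}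
    (hf : Continuous f) (hg : Continuous g) (hfi : Integrable f F) (hgi : Integrable g F)
    (hle : ∀ e, f e ≤ g e) {e₀ : Vec N} (hlt : f e₀ < g e₀) : ∫ e, f e ∂F < ∫ e, g e ∂F := by
  have := hF.isOpenPosMeasure
  have h := integral_pos_of_integrable_nonneg_nonzero (μ := F) (f := fun e => g e - f e)
    (hg.sub hf) (hgi.sub hfi) (fun e => sub_nonneg.2 (hle e)) (x := e₀) (sub_pos.2 hlt).ne'
  rw [integral_sub hgi hfi] at h
  linarith

theorem socialSurplus_smul (F : Measure (Vec N)) (hs : 0 ≤ s) (v : Vec N) :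
    socialSurplus F s (s • v) = s * socialSurplus F 1 v := by
  simp only [socialSurplus_eq, one_smul, ← smul_add, vecMax_smul hs]
  rw [integral_const_mul]

variable [Nonempty (Fin N)]

theorem continuous_vecMax_add_smul (s : ℝ) (θ : Vec N) :
    Continuous fun e : Vec N => vecMax (θ + s • e) :=
  continuous_vecMax.comp (by fun_prop)

theorem ShockAssumption.integrable_vecMax (hF : ShockAssumption F) (s : ℝ) (θ : Vec N) :
    Integrable (fun e : Vec N => vecMax (θ + s • e)) F := by
  have := hF.isProbability
  have h : Integrable (fun e : Vec N => θ + s • e) F :=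
    (integrable_const θ).add (hF.integrable_id.smul s)
  refine h.mono (continuous_vecMax_add_smul s θ).aestronglyMeasurable (ae_of_all _ fun e => ?_)
  have := lipschitzWith_vecMax.dist_le_mul (θ + s • e) 0
  simpa [vecMax_zero] using this

theorem ShockAssumption.apply_le_socialSurplus (hF : ShockAssumption F) (s : ℝ) (θ : Vec N)
    (i : Fin N) : θ i ≤ socialSurplus F s θ := by
  have := hF.isProbability
  have hi : Integrable (fun e : Vec N => s * e i) F := (hF.integrable i).const_mul s
  have h : ∫ e : Vec N, (θ i + s * e i) ∂F = θ i := by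
    rw [integral_add (integrable_const _) hi, integral_const_mul, hF.mean_zero]
    simp
  rw [← h, socialSurplus_eq]
  exact integral_mono ((integrable_const _).add hi) (hF.integrable_vecMax s θ)
    fun e => le_vecMax (θ + s • e) i

theorem ShockAssumption.socialSurplus_add_smul_allOnes (hF : ShockAssumption F) (s : ℝ)
    (θ : Vec N) (c : ℝ) :
    socialSurplus F s (θ + c • allOnes N) = socialSurplus F s θ + c := by
  have := hF.isProbability
  have h : ∀ e : Vec N, vecMax (θ + c • allOnes N + s • e) = vecMax (θ + s • e) + c := fun e => by
    rw [add_right_comm, vecMax_add_smul_allOnes]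
  simp only [socialSurplus_eq, h]
  rw [integral_add (hF.integrable_vecMax s θ) (integrable_const c)]
  simp

theorem ShockAssumption.convexOn_socialSurplus (hF : ShockAssumption F) (s : ℝ) :
    ConvexOn ℝ Set.univ (socialSurplus F s) := by
  refine ⟨convex_univ, fun θ _ θ' _ a b ha hb hab => ?_⟩
  have h1 := (hF.integrable_vecMax s θ).const_mul a
  have h2 := (hF.integrable_vecMax s θ').const_mul b
  simp only [socialSurplus_eq, smul_eq_mul]
  rw [← integral_const_mul, ← integral_const_mul, ← integral_add h1 h2]
  refine integral_mono (hF.integrable_vecMax s _) (h1.add h2) fun e => ?_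
  have : a • θ + b • θ' + s • e = a • (θ + s • e) + b • (θ' + s • e) := by
    rw [smul_add, smul_add, add_add_add_comm, ← add_smul, hab, one_smul]
  simp only [this]
  refine (vecMax_add_le _ _).trans_eq ?_
  rw [vecMax_smul ha, vecMax_smul hb]

/-- Rademacher's theorem makes `e ↦ max (θ + s e)` differentiable for almost every shock. -/
theorem ShockAssumption.ae_differentiableAt_vecMax (hF : ShockAssumption F) (hs : 0 < s)
    (θ : Vec N) : ∀ᵐ e ∂F, DifferentiableAt ℝ (vecMax : Vec N → ℝ) (θ + s • e) := by
  have hl : LipschitzWith ‖s‖₊ fun e : Vec N => vecMax (θ + s • e) := by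
    have h : LipschitzWith ‖s‖₊ fun e : Vec N => θ + s • e := by
      refine LipschitzWith.of_dist_le_mul fun v w => ?_
      simp [dist_eq_norm, ← smul_sub, norm_smul]
    simpa only [one_mul, Function.comp_def] using lipschitzWith_vecMax.comp h
  refine hF.absolutelyContinuous.ae_le ?_
  filter_upwards [hl.ae_differentiableAt (μ := volume)] with e he
  have hg : DifferentiableAt ℝ (fun v : Vec N => s⁻¹ • (v - θ)) (θ + s • e) := by fun_prop
  have hp : s⁻¹ • (θ + s • e - θ) = e := by simp [hs.ne']
  have hc := DifferentiableAt.comp (θ + s • e)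
    (g := fun e : Vec N => vecMax (θ + s • e)) (by simpa only [hp] using he) hg
  have he' : (fun e : Vec N => vecMax (θ + s • e)) ∘ (fun v : Vec N => s⁻¹ • (v - θ)) = vecMax := by
    funext v
    simp [hs.ne']
  rwa [he'] at hc

theorem ShockAssumption.differentiable_socialSurplus (hF : ShockAssumption F) (hs : 0 < s) :
    Differentiable ℝ (socialSurplus F s) := by
  intro θ
  have := hF.isProbability
  have h := hasFDerivAt_integral_of_dominated_loc_of_lip (μ := F) (𝕜 := ℝ) (x₀ := θ)
    (F := fun θ e => vecMax (θ + s • e)) (bound := fun _ => 1)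
    (F' := fun e => fderiv ℝ (vecMax : Vec N → ℝ) (θ + s • e)) (s := Set.univ) univ_mem
    (Eventually.of_forall fun θ => (continuous_vecMax_add_smul s θ).aestronglyMeasurable)
    (hF.integrable_vecMax s θ)
    (((measurable_fderiv ℝ _).comp (by fun_prop)).aestronglyMeasurable)
    (ae_of_all _ fun e => ?_) (integrable_const _) ?_
  · exact h.2.differentiableAt
  · refine LipschitzWith.lipschitzOnWith (LipschitzWith.of_dist_le_mul fun v w => ?_)
    simpa using lipschitzWith_vecMax.dist_le_mul (v + s • e) (w + s • e)
  · filter_upwards [hF.ae_differentiableAt_vecMax hs θ] with e he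
    exact (hasFDerivAt_comp_add_right (s • e)).2 he.hasFDerivAt

end Surplus

section Gradient

variable {N : ℕ} {F : Measure (Vec N)} {s : ℝ}

/-- A convex function on the whole space lies above its tangent hyperplanes. -/
theorem _root_.ConvexOn.add_inner_gradient_le {E : Type*} [NormedAddCommGroup E]
    [InnerProductSpace ℝ E] [CompleteSpace E] {f : E → ℝ} (hf : ConvexOn ℝ Set.univ f) {x : E}
    (hx : DifferentiableAt ℝ f x) (y : E) : f x + inner ℝ (gradient f x) (y - x) ≤ f y := by
  have hc : ConvexOn ℝ Set.univ (f ∘ AffineMap.lineMap (k := ℝ) x y) :=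
    hf.comp_affineMap (AffineMap.lineMap x y)
  have hd : HasDerivAt (f ∘ AffineMap.lineMap (k := ℝ) x y) (fderiv ℝ f x (y - x)) 0 := by
    refine HasFDerivAt.comp_hasDerivAt (0 : ℝ) ?_ AffineMap.hasDerivAt_lineMap
    simpa using hx.hasFDerivAt
  have h := hc.le_slope_of_hasDerivAt (Set.mem_univ 0) (Set.mem_univ 1) zero_lt_one hd
  rw [inner_gradient_left]
  simp only [slope_def_field, Function.comp_apply, AffineMap.lineMap_apply_zero,
    AffineMap.lineMap_apply_one, sub_zero, div_one] at h
  linarith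

/-- The gradient is the only subgradient at a point of differentiability. -/
theorem eq_gradient_of_forall_add_inner_le {E : Type*} [NormedAddCommGroup E]
    [InnerProductSpace ℝ E] [CompleteSpace E] {f : E → ℝ} {x z : E} (hx : DifferentiableAt ℝ f x)
    (h : ∀ y, f x + inner ℝ z (y - x) ≤ f y) : z = gradient f x := by
  have hg : HasGradientAt (fun y => f y - inner ℝ z y) (gradient f x - z) x := by
    have h2 := hx.hasFDerivAt.sub ((innerSL ℝ z).hasFDerivAt (x := x))
    have h3 : InnerProductSpace.toDual ℝ E (gradient f x - z) = fderiv ℝ f x - innerSL ℝ z := by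
      rw [map_sub, toDual_gradient]
      rfl
    rw [hasGradientAt_iff_hasFDerivAt, h3]
    exact h2
  have hm : IsLocalMin (fun y => f y - inner ℝ z y) x := Eventually.of_forall fun y => by
    have := h y
    rw [inner_sub_right] at this
    show f x - inner ℝ z x ≤ f y - inner ℝ z y
    linarith
  have h0 := hm.hasFDerivAt_eq_zero hg.hasFDerivAt
  rw [LinearIsometryEquiv.map_eq_zero_iff, sub_eq_zero] at h0
  exact h0.symm

variable [Nonempty (Fin N)]

theorem ShockAssumption.add_inner_gradient_le (hF : ShockAssumption F) (hs : 0 < s)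
    (θ θ' : Vec N) :
    socialSurplus F s θ + inner ℝ (gradient (socialSurplus F s) θ) (θ' - θ) ≤
      socialSurplus F s θ' :=
  (hF.convexOn_socialSurplus s).add_inner_gradient_le (hF.differentiable_socialSurplus hs θ) θ'

theorem ShockAssumption.gradient_socialSurplus_pos (hF : ShockAssumption F) (hs : 0 < s)
    (θ : Vec N) : gradient (socialSurplus F s) θ ∈ posOrthant N := by
  intro i
  have hmono : ∀ e : Vec N,
      vecMax (θ - EuclideanSpace.single i 1 + s • e) ≤ vecMax (θ + s • e) := fun e => by
    refine vecMax_mono fun j => ?_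
    have : (0 : ℝ) ≤ (Pi.single i 1 : Fin N → ℝ) j := by
      rw [Pi.single_apply]; positivity
    simpa [Pi.single_apply] using this
  have h1 : socialSurplus F s (θ - EuclideanSpace.single i 1) < socialSurplus F s θ := by
    rw [socialSurplus_eq, socialSurplus_eq]
    refine hF.integral_lt_integral (continuous_vecMax_add_smul s _)
      (continuous_vecMax_add_smul s θ) (hF.integrable_vecMax s _) (hF.integrable_vecMax s θ) hmono
      (e₀ := s⁻¹ • (EuclideanSpace.single i 1 - θ)) ?_
    have h2 := le_vecMax (EuclideanSpace.single i 1 : Vec N) i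
    simp only [smul_inv_smul₀ hs.ne', sub_add_sub_cancel, add_sub_cancel, sub_self, vecMax_zero]
    simp at h2
    linarith
  have h2 := hF.add_inner_gradient_le hs θ (θ - EuclideanSpace.single i 1)
  have h3 : inner ℝ (gradient (socialSurplus F s) θ) (EuclideanSpace.single i (1 : ℝ)) =
      gradient (socialSurplus F s) θ i := by
    rw [inner_eq_sum]
    simp
  rw [sub_sub_cancel_left, inner_neg_right, h3] at h2
  linarith

theorem ShockAssumption.sum_gradient_socialSurplus (hF : ShockAssumption F) (hs : 0 < s)
    (θ : Vec N) : ∑ i, gradient (socialSurplus F s) θ i = 1 := by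
  have h : ∀ c : ℝ, c * ∑ i, gradient (socialSurplus F s) θ i ≤ c := fun c => by
    have h1 := hF.add_inner_gradient_le hs θ (θ + c • allOnes N)
    rw [hF.socialSurplus_add_smul_allOnes, add_sub_cancel_left, inner_smul_right,
      inner_allOnes] at h1
    linarith
  have h1 := h 1
  have h2 := h (-1)
  linarith

theorem ShockAssumption.gradient_socialSurplus_mem_simplex (hF : ShockAssumption F) (hs : 0 < s)
    (θ : Vec N) : gradient (socialSurplus F s) θ ∈ simplex N :=
  ⟨fun i => (hF.gradient_socialSurplus_pos hs θ i).le, hF.sum_gradient_socialSurplus hs θ⟩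

theorem ShockAssumption.gradient_socialSurplus_add_smul_allOnes (hF : ShockAssumption F)
    (hs : 0 < s) (θ : Vec N) (c : ℝ) :
    gradient (socialSurplus F s) (θ + c • allOnes N) = gradient (socialSurplus F s) θ := by
  symm
  refine eq_gradient_of_forall_add_inner_le (hF.differentiable_socialSurplus hs _) fun v => ?_
  have h := hF.add_inner_gradient_le hs θ v
  rw [hF.socialSurplus_add_smul_allOnes, ← sub_sub, inner_sub_right, inner_smul_right,
    inner_allOnes, hF.sum_gradient_socialSurplus hs]
  linarith

theorem ShockAssumption.gradient_socialSurplus_smul (hF : ShockAssumption F) (hs : 0 < s)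
    (v : Vec N) : gradient (socialSurplus F s) (s • v) = gradient (socialSurplus F 1) v := by
  refine eq_gradient_of_forall_add_inner_le (hF.differentiable_socialSurplus one_pos _) fun w => ?_
  have h := hF.add_inner_gradient_le hs (s • v) (s • w)
  rw [socialSurplus_smul F hs.le, socialSurplus_smul F hs.le, ← smul_sub, inner_smul_right,
    ← mul_add] at h
  exact le_of_mul_le_mul_left h hs

/-- The midpoint inequality for the surplus is strict unless the two points differ by a constant
vector. -/
theorem ShockAssumption.exists_eq_add_smul_allOnes (hF : ShockAssumption F) (hs : 0 < s)
    {θ d : Vec N}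
    (h : socialSurplus F s (θ + d) + socialSurplus F s (θ - d) ≤ 2 * socialSurplus F s θ) :
    ∃ c : ℝ, d = c • allOnes N := by
  refine ⟨vecMax d, eq_smul_allOnes_of_vecMax_add_vecMax_neg_le ?_⟩
  by_contra! hpos
  refine h.not_gt ?_
  have hi1 := hF.integrable_vecMax s (θ + d)
  have hi2 := hF.integrable_vecMax s (θ - d)
  simp only [socialSurplus_eq]
  rw [← integral_const_mul, ← integral_add hi1 hi2]
  refine hF.integral_lt_integral ((continuous_vecMax_add_smul s θ).const_mul 2)
    ((continuous_vecMax_add_smul s _).add (continuous_vecMax_add_smul s _))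
    ((hF.integrable_vecMax s θ).const_mul 2) (hi1.add hi2) (fun e => ?_) (e₀ := s⁻¹ • (-θ)) ?_
  · rw [← vecMax_smul zero_le_two]
    refine le_of_eq_of_le ?_ (vecMax_add_le _ _)
    congr 1
    module
  · simpa [smul_inv_smul₀ hs.ne', vecMax_zero, sub_eq_add_neg, add_right_comm] using hpos

theorem ShockAssumption.exists_eq_add_smul_allOnes_of_gradient_eq (hF : ShockAssumption F)
    (hs : 0 < s) {θ θ' : Vec N}
    (h : gradient (socialSurplus F s) θ = gradient (socialSurplus F s) θ') :
    ∃ c : ℝ, θ' = θ + c • allOnes N := by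
  set d : Vec N := (1 / 2 : ℝ) • (θ' - θ) with hd
  have e1 : θ + d + d = θ' := by rw [hd]; module
  have h1 := hF.add_inner_gradient_le hs θ (θ + d)
  have h2 := hF.add_inner_gradient_le hs θ' (θ + d)
  rw [add_sub_cancel_left] at h1
  rw [← h, show θ + d - θ' = -d by rw [← e1]; abel, inner_neg_right] at h2
  obtain ⟨c, hc⟩ := hF.exists_eq_add_smul_allOnes hs (θ := θ + d) (d := d) (by
    rw [e1, add_sub_cancel_right]; linarith)
  refine ⟨2 * c, ?_⟩
  rw [← e1, hc]
  module

end Gradient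

section Conjugate

variable {N : ℕ} {F : Measure (Vec N)} {s : ℝ}

theorem le_regularizer (F : Measure (Vec N)) (s : ℝ) (θ x : Vec N) :
    ((inner ℝ θ x - socialSurplus F s θ : ℝ) : EReal) ≤ regularizer F s x :=
  le_iSup (fun θ : Vec N => ((inner ℝ θ x - socialSurplus F s θ : ℝ) : EReal)) θ

theorem inner_sub_regularizer_le (F : Measure (Vec N)) (s : ℝ) (θ x : Vec N) :
    ((inner ℝ θ x : ℝ) : EReal) - regularizer F s x ≤ (socialSurplus F s θ : ℝ) := by
  refine (EReal.sub_le_sub le_rfl (le_regularizer F s θ x)).trans_eq ?_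
  rw [← EReal.coe_sub, sub_sub_cancel]

variable [Nonempty (Fin N)]

theorem ShockAssumption.regularizer_gradient (hF : ShockAssumption F) (hs : 0 < s) (θ : Vec N) :
    regularizer F s (gradient (socialSurplus F s) θ) =
      ((inner ℝ θ (gradient (socialSurplus F s) θ) - socialSurplus F s θ : ℝ) : EReal) := by
  refine le_antisymm (iSup_le fun v => ?_) (le_regularizer F s θ _)
  rw [EReal.coe_le_coe_iff]
  have h := hF.add_inner_gradient_le hs θ v
  rw [inner_sub_right, real_inner_comm, real_inner_comm θ] at h
  linarith

/-- Fenchel equality characterizes the gradient. -/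
theorem ShockAssumption.eq_gradient_of_le_inner_sub_regularizer (hF : ShockAssumption F)
    (hs : 0 < s) {θ x : Vec N}
    (h : (socialSurplus F s θ : EReal) ≤ ((inner ℝ θ x : ℝ) : EReal) - regularizer F s x) :
    x = gradient (socialSurplus F s) θ := by
  refine eq_gradient_of_forall_add_inner_le (hF.differentiable_socialSurplus hs θ) fun v => ?_
  have h1 := h.trans (EReal.sub_le_sub le_rfl (le_regularizer F s v x))
  rw [← EReal.coe_sub, EReal.coe_le_coe_iff] at h1
  rw [inner_sub_right, real_inner_comm, real_inner_comm θ]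
  linarith

theorem ShockAssumption.isRegularizedLeader_iff (hF : ShockAssumption F) (hs : 0 < s)
    {θ x : Vec N} : IsRegularizedLeader F s θ x ↔ x = gradient (socialSurplus F s) θ := by
  have hval : ((inner ℝ θ (gradient (socialSurplus F s) θ) : ℝ) : EReal) -
      regularizer F s (gradient (socialSurplus F s) θ) = (socialSurplus F s θ : ℝ) := by
    rw [hF.regularizer_gradient hs, ← EReal.coe_sub, sub_sub_cancel]
  constructor
  · rintro ⟨-, hmax⟩
    exact hF.eq_gradient_of_le_inner_sub_regularizer hs
      (hval.symm.trans_le (hmax (hF.gradient_socialSurplus_mem_simplex hs θ)))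
  · rintro rfl
    refine ⟨hF.gradient_socialSurplus_mem_simplex hs θ, fun z _ => ?_⟩
    exact (inner_sub_regularizer_le F s θ z).trans_eq hval.symm

end Conjugate

section ExpSurplus

variable {N : ℕ} {F : Measure (Vec N)} {s : ℝ}

theorem vlog_vexp (v : Vec N) : vlog (vexp v) = v := by
  ext i
  simp [vlog, vexp]

theorem vexp_vlog {y : Vec N} (hy : y ∈ posOrthant N) : vexp (vlog y) = y := by
  ext i
  simp [vlog, vexp, Real.exp_log (hy i)]

theorem vexp_mem_posOrthant (v : Vec N) : vexp v ∈ posOrthant N :=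
  fun i => Real.exp_pos (v i)

/-- `exp t / n - y t` grows at least linearly in `|t|`. -/
theorem mul_abs_sub_le_exp_div_sub {n : ℝ} (hn : 0 < n) (y t : ℝ) :
    y * |t| - 2 * n * y ^ 2 ≤ Real.exp t / n - y * t := by
  rcases le_or_gt t 0 with ht | ht
  · rw [abs_of_nonpos ht]
    have : 0 < Real.exp t / n := div_pos (Real.exp_pos t) hn
    nlinarith [mul_nonneg hn.le (sq_nonneg y)]
  · rw [abs_of_pos ht]
    have h1 : t ^ 2 / 2 ≤ Real.exp t := by
      have := Real.quadratic_le_exp_of_nonneg ht.le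
      linarith
    have h2 : t ^ 2 / 2 / n ≤ Real.exp t / n := by gcongr
    have h3 : t ^ 2 / 2 / n - 2 * y * t + 2 * n * y ^ 2 = (t - 2 * n * y) ^ 2 / (2 * n) := by
      field_simp
      ring
    have h4 : 0 ≤ (t - 2 * n * y) ^ 2 / (2 * n) := by positivity
    linarith

variable [Nonempty (Fin N)]

theorem ShockAssumption.hasGradientAt_exp_socialSurplus (hF : ShockAssumption F) (hs : 0 < s)
    (θ : Vec N) :
    HasGradientAt (fun θ => Real.exp (socialSurplus F s θ))
      (Real.exp (socialSurplus F s θ) • gradient (socialSurplus F s) θ) θ := by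
  have h := (hF.differentiable_socialSurplus hs θ).hasGradientAt.hasFDerivAt.exp
  rw [hasGradientAt_iff_hasFDerivAt]
  simpa using h

theorem ShockAssumption.expSurplusGrad_vexp_eq (hF : ShockAssumption F) (hs : 0 < s) (v : Vec N) :
    expSurplusGrad F s (vexp v) =
      Real.exp (socialSurplus F s (s • v)) • gradient (socialSurplus F 1) v := by
  rw [expSurplusGrad, vlog_vexp, (hF.hasGradientAt_exp_socialSurplus hs _).gradient,
    hF.gradient_socialSurplus_smul hs]

theorem ShockAssumption.sum_expSurplusGrad_vexp (hF : ShockAssumption F) (hs : 0 < s)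
    (v : Vec N) :
    ∑ i, expSurplusGrad F s (vexp v) i = Real.exp (socialSurplus F s (s • v)) := by
  simp only [hF.expSurplusGrad_vexp_eq hs, PiLp.smul_apply, smul_eq_mul]
  rw [← Finset.mul_sum, hF.sum_gradient_socialSurplus one_pos, mul_one]

theorem ShockAssumption.expSurplusGrad_vexp_div_sum (hF : ShockAssumption F) (hs : 0 < s)
    (v : Vec N) (i : Fin N) :
    expSurplusGrad F s (vexp v) i / ∑ j, expSurplusGrad F s (vexp v) j =
      gradient (socialSurplus F 1) v i := by
  rw [hF.sum_expSurplusGrad_vexp hs, hF.expSurplusGrad_vexp_eq hs, PiLp.smul_apply, smul_eq_mul,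
    mul_div_cancel_left₀ _ (Real.exp_pos _).ne']

theorem ShockAssumption.mapsTo_expSurplusGrad (hF : ShockAssumption F) (hs : 0 < s) :
    Set.MapsTo (expSurplusGrad F s) (posOrthant N) (posOrthant N) := by
  intro y hy i
  rw [← vexp_vlog hy, hF.expSurplusGrad_vexp_eq hs]
  exact mul_pos (Real.exp_pos _) (hF.gradient_socialSurplus_pos one_pos _ i)

theorem ShockAssumption.injOn_expSurplusGrad (hF : ShockAssumption F) (hs : 0 < s) :
    Set.InjOn (expSurplusGrad F s) (posOrthant N) := by
  intro y hy z hz h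
  rw [← vexp_vlog hy, ← vexp_vlog hz] at h ⊢
  have hsum := hF.sum_expSurplusGrad_vexp hs (vlog y)
  rw [h, hF.sum_expSurplusGrad_vexp hs, Real.exp_eq_exp] at hsum
  have hgrad : gradient (socialSurplus F 1) (vlog y) = gradient (socialSurplus F 1) (vlog z) := by
    ext i
    rw [← hF.expSurplusGrad_vexp_div_sum hs, ← hF.expSurplusGrad_vexp_div_sum hs, h]
  obtain ⟨c, hc⟩ := hF.exists_eq_add_smul_allOnes_of_gradient_eq one_pos hgrad
  rw [hc, smul_add, smul_smul, hF.socialSurplus_add_smul_allOnes] at hsum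
  have h0 : c = 0 := by
    have : s * c = 0 := by linarith
    simpa [hs.ne'] using this
  rw [hc, h0, zero_smul, add_zero]

theorem ShockAssumption.le_exp_socialSurplus_sub_inner (hF : ShockAssumption F) (s : ℝ)
    (y θ : Vec N) :
    ∑ i, (y i * |θ i| - 2 * N * y i ^ 2) ≤
      Real.exp (socialSurplus F s θ) - inner ℝ y θ := by
  have hN : (0 : ℝ) < N := by
    have := Fintype.card_pos (α := Fin N)
    rw [Fintype.card_fin] at this
    exact_mod_cast this
  calc ∑ i, (y i * |θ i| - 2 * N * y i ^ 2)
      ≤ ∑ i, (Real.exp (θ i) / N - y i * θ i) :=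
        Finset.sum_le_sum fun i _ => mul_abs_sub_le_exp_div_sub hN (y i) (θ i)
    _ ≤ ∑ i : Fin N, (Real.exp (socialSurplus F s θ) / N - y i * θ i) := by
        gcongr with i
        exact hF.apply_le_socialSurplus s θ i
    _ = Real.exp (socialSurplus F s θ) - inner ℝ y θ := by
        rw [Finset.sum_sub_distrib, inner_eq_sum]
        simp [mul_div_cancel₀, hN.ne']

theorem ShockAssumption.tendsto_exp_socialSurplus_sub_inner (hF : ShockAssumption F) (s : ℝ)
    {y : Vec N} (hy : y ∈ posOrthant N) :
    Tendsto (fun θ => Real.exp (socialSurplus F s θ) - inner ℝ y θ) (cocompact (Vec N)) atTop := by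
  obtain ⟨k, hk⟩ := Finite.exists_min fun i => y i
  have hnorm : ∀ θ : Vec N, ‖θ‖ ≤ ∑ i, |θ i| := fun θ => by
    have h : θ = ∑ i, θ i • EuclideanSpace.single i (1 : ℝ) := by
      ext j
      simp [Pi.single_apply]
    calc ‖θ‖ = ‖∑ i, θ i • EuclideanSpace.single i (1 : ℝ)‖ := by rw [← h]
      _ ≤ ∑ i, ‖θ i • EuclideanSpace.single i (1 : ℝ)‖ := norm_sum_le _ _
      _ = ∑ i, |θ i| := by simp [norm_smul]
  have ht : Tendsto (fun θ : Vec N => y k * ‖θ‖ + -∑ i, 2 * N * y i ^ 2)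
      (cocompact (Vec N)) atTop :=
    tendsto_atTop_add_const_right _ _ ((tendsto_norm_cocompact_atTop).const_mul_atTop (hy k))
  refine tendsto_atTop_mono (fun θ => ?_) ht
  refine le_trans ?_ (hF.le_exp_socialSurplus_sub_inner s y θ)
  rw [Finset.sum_sub_distrib, ← sub_eq_add_neg]
  gcongr
  calc y k * ‖θ‖ ≤ y k * ∑ i, |θ i| := mul_le_mul_of_nonneg_left (hnorm θ) (hy k).le
    _ = ∑ i, y k * |θ i| := Finset.mul_sum _ _ _
    _ ≤ ∑ i, y i * |θ i| :=
      Finset.sum_le_sum fun i _ => mul_le_mul_of_nonneg_right (hk i) (abs_nonneg _)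

theorem ShockAssumption.surjOn_expSurplusGrad (hF : ShockAssumption F) (hs : 0 < s) :
    Set.SurjOn (expSurplusGrad F s) (posOrthant N) (posOrthant N) := by
  intro y hy
  have hd : Differentiable ℝ fun θ => Real.exp (socialSurplus F s θ) :=
    (hF.differentiable_socialSurplus hs).exp
  have hcont : Continuous fun θ : Vec N => Real.exp (socialSurplus F s θ) - inner ℝ y θ :=
    hd.continuous.sub (by fun_prop)
  obtain ⟨θ, hθ⟩ := hcont.exists_forall_le (hF.tendsto_exp_socialSurplus_sub_inner s hy)
  refine ⟨vexp (s⁻¹ • θ), vexp_mem_posOrthant _, ?_⟩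
  rw [expSurplusGrad_vexp F hs]
  refine (eq_gradient_of_forall_add_inner_le (hd θ) fun v => ?_).symm
  have := hθ v
  rw [inner_sub_right]
  linarith

theorem ShockAssumption.bijOn_expSurplusGrad (hF : ShockAssumption F) (hs : 0 < s) :
    Set.BijOn (expSurplusGrad F s) (posOrthant N) (posOrthant N) :=
  ⟨hF.mapsTo_expSurplusGrad hs, hF.injOn_expSurplusGrad hs, hF.surjOn_expSurplusGrad hs⟩

theorem ShockAssumption.expSurplusGrad_vexp_alpha (hF : ShockAssumption F) (hs : 0 < s)
    {x : Vec N} (hx : x ∈ posOrthant N) : expSurplusGrad F s (vexp (alpha F s x)) = x := by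
  have h := hF.surjOn_expSurplusGrad hs hx
  rw [alpha, invExpSurplusGrad, vexp_vlog (Function.invFunOn_mem h), Function.invFunOn_eq h]

/-- On choice probabilities, `α` recovers the utility vector up to a constant. -/
theorem ShockAssumption.exists_alpha_gradient_eq (hF : ShockAssumption F) (hs : 0 < s)
    (v : Vec N) :
    ∃ c : ℝ, alpha F s (gradient (socialSurplus F 1) v) = v + c • allOnes N := by
  refine hF.exists_eq_add_smul_allOnes_of_gradient_eq one_pos ?_
  ext i
  rw [← hF.expSurplusGrad_vexp_div_sum hs (alpha F s (gradient (socialSurplus F 1) v)),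
    hF.expSurplusGrad_vexp_alpha hs (hF.gradient_socialSurplus_pos one_pos v),
    hF.sum_gradient_socialSurplus one_pos, div_one]

end ExpSurplus

end RumOdp

theorem mainTheorem7 (N : ℕ) (hN : 0 < N)
    (F : MeasureTheory.Measure (RumOdp.Vec N)) (hF : RumOdp.ShockAssumption F)
    (η : ℝ) (hη : 0 < η) (L : ℝ) (hL : 0 < L)
    (T : ℕ) (u : ℕ → RumOdp.Vec N)
    (hHess : ∀ t, 1 ≤ t → t ≤ T →
      RumOdp.HessianTraceBound F η L (RumOdp.cumulativePayoff u t)) :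
    -- the FTRL step is well defined
    (∀ θ : RumOdp.Vec N, ∃! x, RumOdp.IsRegularizedLeader F η θ x) ∧
    -- `s = η`: exponentiated surplus of `φ` itself; `s = 1`: normalization of degree one
    ∀ s : ℝ, s = η ∨ s = 1 →
      -- `H` is invertible, so that `Φ` is meaningful
      Set.BijOn (RumOdp.expSurplusGrad F s) (RumOdp.posOrthant N) (RumOdp.posOrthant N) ∧
      ∀ x : ℕ → RumOdp.Vec N, RumOdp.IsFTRL F η T u x →
        (∀ t, 1 ≤ t → t ≤ T + 1 → x t ∈ RumOdp.posOrthant N) ∧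
        ∀ t, 1 ≤ t → t ≤ T → ∀ i : Fin N,
          x (t + 1) i =
            RumOdp.expSurplusGrad F s (RumOdp.vexp (η⁻¹ • u t + RumOdp.alpha F s (x t))) i /
              ∑ j : Fin N,
                RumOdp.expSurplusGrad F s
                  (RumOdp.vexp (η⁻¹ • u t + RumOdp.alpha F s (x t))) j := by
  have : Nonempty (Fin N) := ⟨⟨0, hN⟩⟩
  refine ⟨fun θ => ⟨_, (hF.isRegularizedLeader_iff hη).2 rfl,
    fun x hx => (hF.isRegularizedLeader_iff hη).1 hx⟩, fun s hs' => ?_⟩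
  have hs : 0 < s := by rcases hs' with rfl | rfl; exacts [hη, one_pos]
  refine ⟨hF.bijOn_expSurplusGrad hs, fun x hx => ?_⟩
  have hx' : ∀ t ≤ T, x (t + 1) =
      gradient (RumOdp.socialSurplus F 1) (η⁻¹ • RumOdp.cumulativePayoff u t) := fun t ht => by
    rw [(hF.isRegularizedLeader_iff hη).1 (hx t ht), ← hF.gradient_socialSurplus_smul hη,
      smul_inv_smul₀ hη.ne']
  refine ⟨fun t h1 ht => ?_, fun t h1 ht i => ?_⟩
  · obtain ⟨r, rfl⟩ := Nat.exists_eq_add_of_le' h1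
    rw [hx' r (by omega)]
    exact hF.gradient_socialSurplus_pos one_pos _
  · obtain ⟨r, rfl⟩ := Nat.exists_eq_add_of_le' h1
    rw [hF.expSurplusGrad_vexp_div_sum hs, hx' (r + 1) ht, hx' r (by omega)]
    obtain ⟨c, hc⟩ := hF.exists_alpha_gradient_eq hs (η⁻¹ • RumOdp.cumulativePayoff u r)
    have hsum : RumOdp.cumulativePayoff u (r + 1) =
        u (r + 1) + RumOdp.cumulativePayoff u r := by
      rw [RumOdp.cumulativePayoff, RumOdp.cumulativePayoff,
        Finset.sum_Icc_succ_top (by omega), add_comm]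
    rw [hc, ← add_assoc, ← smul_add, ← hsum, hF.gradient_socialSurplus_add_smul_allOnes one_pos]
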